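/- **Setting.** An influence graph $G=(V,E,(p_{uv})_{(u,v)\in E})$ is a finite directed graph with an activation probability $p_{uv}\in[0,1]$ on each edge. Its random live-edge graph $L$ contains each edge $(u,v)\in E$ independently with probability $p_{uv}$. For $S\subseteq V$ let $R(S,L)$ be the set of nodes reachable in $L$ from a node of $S$, and let $\sigma(S)=\mathbb E_L[|R(S,L)|]$. For an integer $k\ge 1$ let $OPT_N(G,k)$ be the maximum of $\sigma(S)$ over the sets $S\subseteq V$ with $|S|=k$. A partial realisation is a map $\psi:S\to 2^V$ with $S\subseteq V$ such that, for some live-edge graph $L$, $\psi(v)=R(\{v\},L)$ for all $v\in S$. An adaptive policy $\pi$ (with full-adoption feedback) assigns to each partial realisation either a node or STOP. It is run on a live-edge graph $L$ as follows: start with the empty partial realisation $\psi$; as long as $\pi(\psi)\ne$ STOP, let $v=\pi(\psi)$ and add $(v,R(\{v\},L))$ to $\psi$. Let $\psi_{\pi,L}$ be the partial realisation at the end. We write $|\pi|=k$ if, for every $L$, the run ends and the domain of $\psi_{\pi,L}$ has exactly $k$ elements. The expected influence spread is $\sigma(\pi)=\mathbb E_L\big[\big|\bigcup_{v\in \mathrm{dom}(\psi_{\pi,L})}\psi_{\pi,L}(v)\big|\big]$,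 and $OPT_A(G,k)$ is the maximum of $\sigma(\pi)$ over the policies with $|\pi|=k$. For a class $\mathcal G$ of influence graphs, the $k$-adaptivity gap is $$AG(\mathcal G,k)=\sup_{G\in\mathcal G}\frac{OPT_A(G,k)}{OPT_N(G,k)},$$ where the supremum is over the graphs in $\mathcal G$ with at least $k$ nodes, and the adaptivity gap is $AG(\mathcal G)=\sup_{k\ge1}AG(\mathcal G,k)$. For an integer $\alpha\ge 0$, an influence graph is $\alpha$-bounded if its underlying graph is a simple undirected graph (each undirected edge $\{u,v\}$ stands for the two directed edges $(u,v)$ and $(v,u)$, with possibly distinct probabilities $p_{uv}$ and $p_{vu}$) in which the sum of the degrees of all nodes of degree greater than $2$ is at most $\alpha$. **Theorem 5.1.** For an integer $\alpha\ge 0$ let $\mathcal G_\alpha$ be the class of $\alpha$-bounded influence graphs. Then for all integers $\alpha\ge0$ and $k\ge 2$, $$AG(\mathcal G_\alpha,k)\le\min\left\{k,\ \frac{\alpha}{k}+2+\frac{1}{1-(1-1/k)^k}\right\}\le\frac{\sqrt{4(e-1)^2\alpha+(3e-2)^2}+3e-2}{2(e-1)}.$$ Consequently, for every integer $\alpha\ge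 0$, $$AG(\mathcal G_\alpha)\le\frac{\sqrt{4(e-1)^2\alpha+(3e-2)^2}+3e-2}{2(e-1)},$$ and there is an absolute constant $C$ with $AG(\mathcal G_\alpha)\le\sqrt{\alpha}+C$ for all integers $\alpha\ge 0$. -/

import Mathlib

universe u

/-- An influence graph `G = (V, E, (p_e)_{e ∈ E})`: a finite directed graph together with an
activation probability `p e ∈ [0,1]` for every edge `e`. -/
structure InfluenceGraph : Type (u + 1) where
  V : Type u
  [fintypeV : Fintype V]
  graph : Digraph V
  p : {e : V × V // graph.Adj e.1 e.2} → ℝ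
  p_mem : ∀ e, p e ∈ Set.Icc (0 : ℝ) 1

attribute [instance] InfluenceGraph.fintypeV

noncomputable section

namespace InfluenceGraph

open scoped Classical

/-- The type of (directed) edges of `G`. -/
abbrev Edge (G : InfluenceGraph.{u}) : Type u := {e : G.V × G.V // G.graph.Adj e.1 e.2}

/-- A live-edge graph on `G`, given by its set `L(E) ⊆ E` of live edges. -/
abbrev LiveEdgeGraph (G : InfluenceGraph.{u}) : Type u := Finset G.Edge

/-- The probability that the random live-edge graph is `L`: each edge `e` is live
with probability `p e`, independently of the other edges. -/
def liveProb (G : InfluenceGraph.{u}) (L : G.LiveEdgeGraph) : ℝ :=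
  (∏ e ∈ L, G.p e) * ∏ e ∈ Lᶜ, (1 - G.p e)

/-- The expectation `𝔼_L[X(L)]` over the random live-edge graph `L`. -/
def expect (G : InfluenceGraph.{u}) (X : G.LiveEdgeGraph → ℝ) : ℝ :=
  ∑ L : G.LiveEdgeGraph, G.liveProb L * X L

/-- The set `R(S, L)` of the nodes that are reachable in `L` from some node of `S`. -/
def reach (G : InfluenceGraph.{u}) (S : Finset G.V) (L : G.LiveEdgeGraph) : Finset G.V :=
  Finset.univ.filter fun v => ∃ s ∈ S,
    Relation.ReflTransGen (fun a b => ∃ h : G.graph.Adj a b, (⟨(a, b), h⟩ : G.Edge) ∈ L) s v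

/-- The expected influence spread `σ(S) = 𝔼_L[|R(S, L)|]` of a seed set `S`. -/
def spread (G : InfluenceGraph.{u}) (S : Finset G.V) : ℝ :=
  G.expect fun L => ((G.reach S L).card : ℝ)

/-- `OPT_N(G, k)`: the optimal value of `σ(S)` over the seed sets `S` with `|S| = k`. -/
def optN (G : InfluenceGraph.{u}) (k : ℕ) : ℝ :=
  sSup {x : ℝ | ∃ S : Finset G.V, S.card = k ∧ x = G.spread S}

/-- The realisation `φ_L : V → 2^V` associated to `L`: `φ_L(v) = R({v}, L)`. -/
def realisation (G : InfluenceGraph.{u}) (L : G.LiveEdgeGraph) (v : G.V) : Finset G.V :=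
  G.reach {v} L

/-- A partial realisation: a partial function `ψ` from `V` to `2^V` (`none` means "undefined")
that is a restriction of the realisation `φ_L` of some live-edge graph `L`. -/
def PartialRealisation (G : InfluenceGraph.{u}) : Type u :=
  {ψ : G.V → Option (Finset G.V) //
    ∃ L : G.LiveEdgeGraph, ∀ v, ψ v = none ∨ ψ v = some (G.realisation L v)}

/-- The domain `dom(ψ)`. -/
def PartialRealisation.dom {G : InfluenceGraph.{u}} (ψ : G.PartialRealisation) : Finset G.V :=
  Finset.univ.filter fun v => (ψ.1 v).isSome

/-- `R(ψ) = ⋃_{v ∈ dom(ψ)} ψ(v)`, the set of nodes reached from the seeds in `dom(ψ)`. -/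
def PartialRealisation.reached {G : InfluenceGraph.{u}} (ψ : G.PartialRealisation) :
    Finset G.V :=
  Finset.univ.filter fun w => ∃ v, ∃ A, ψ.1 v = some A ∧ w ∈ A

/-- The restriction of `φ_L` to `S`, i.e. `{(v, R({v}, L)) : v ∈ S}`. -/
def restrict (G : InfluenceGraph.{u}) (L : G.LiveEdgeGraph) (S : Finset G.V) :
    G.PartialRealisation :=
  ⟨fun v => if v ∈ S then some (G.realisation L v) else none, L, fun v => by
    by_cases h : v ∈ S <;> simp [h]⟩

/-- A (deterministic) adaptive policy with full-adoption feedback: given the partial realisation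
observed so far it returns either the next seed node, or `none`, meaning STOP. -/
def Policy (G : InfluenceGraph.{u}) : Type u := G.PartialRealisation → Option G.V

namespace Policy

variable {G : InfluenceGraph.{u}}

/-- The set of nodes that the policy `π` has activated as seeds after `j` rounds of its run on the
live-edge graph `L`. The partial realisation observed at that time is the restriction of `φ_L`
to this set; once the policy says STOP, nothing changes any more. -/
def seeds (π : G.Policy) (L : G.LiveEdgeGraph) : ℕ → Finset G.V
  | 0 => ∅
  | j + 1 =>
    match π (G.restrict L (seeds π L j)) with
    | none => seeds π L j
    | some v => insert v (seeds π L j)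

/-- The partial realisation observed after `j` rounds of the run of `π` on `L`. -/
def observed (π : G.Policy) (L : G.LiveEdgeGraph) (j : ℕ) : G.PartialRealisation :=
  G.restrict L (π.seeds L j)

/-- The run of `π` on `L` reaches STOP. -/
def Halts (π : G.Policy) (L : G.LiveEdgeGraph) : Prop := ∃ j, π (π.observed L j) = none

/-- The partial realisation `ψ_{π,L}` returned by the run of `π` on `L`. A run that reaches STOP
does so after at most `|V|` rounds, see `output_eq_of_eq_none` below. -/
def output (π : G.Policy) (L : G.LiveEdgeGraph) : G.PartialRealisation :=
  π.observed L (Fintype.card G.V)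

/-- `|π| = k`: on every live-edge graph `L` the run of `π` ends, and the partial realisation that
it returns has a domain of cardinality `k`. -/
def HasSize (π : G.Policy) (k : ℕ) : Prop :=
  ∀ L : G.LiveEdgeGraph, π.Halts L ∧ (π.output L).dom.card = k

/-- The expected influence spread `σ(π) = 𝔼_L[|R(ψ_{π,L})|]` of a policy. -/
def spread (π : G.Policy) : ℝ := G.expect fun L => ((π.output L).reached.card : ℝ)

theorem seeds_succ_of_eq_none (π : G.Policy) (L : G.LiveEdgeGraph) {j : ℕ}
    (h : π (π.observed L j) = none) : π.seeds L (j + 1) = π.seeds L j := by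
  have h2 : π (G.restrict L (π.seeds L j)) = none := h
  rw [seeds, h2]

theorem seeds_subset_succ (π : G.Policy) (L : G.LiveEdgeGraph) (j : ℕ) :
    π.seeds L j ⊆ π.seeds L (j + 1) := by
  rw [seeds]
  split
  · exact Finset.Subset.refl _
  · exact Finset.subset_insert _ _

theorem seeds_mono (π : G.Policy) (L : G.LiveEdgeGraph) : Monotone (π.seeds L) :=
  monotone_nat_of_le_succ fun j => π.seeds_subset_succ L j

theorem seeds_const (π : G.Policy) (L : G.LiveEdgeGraph) {j : ℕ}
    (h : π.seeds L (j + 1) = π.seeds L j) (m : ℕ) : π.seeds L (j + m) = π.seeds L j := by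
  induction m with
  | zero => rfl
  | succ m ih =>
    rw [← add_assoc, seeds, ih, ← h]
    conv_rhs => rw [seeds]
    rw [h]

/-- If the run of `π` on `L` stops at round `j`, then the partial realisation observed at that
round is the output. -/
theorem output_eq_of_eq_none (π : G.Policy) (L : G.LiveEdgeGraph) {j : ℕ}
    (h : π (π.observed L j) = none) : π.output L = π.observed L j := by
  suffices hs : π.seeds L (Fintype.card G.V) = π.seeds L j by
    unfold output observed
    rw [hs]
  rcases le_total j (Fintype.card G.V) with hj | hj
  · obtain ⟨m, hm⟩ := Nat.exists_eq_add_of_le hj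
    rw [hm]
    exact π.seeds_const L (π.seeds_succ_of_eq_none L h) m
  · by_cases hex : ∃ i < Fintype.card G.V, π.seeds L (i + 1) = π.seeds L i
    · obtain ⟨i, hi, he⟩ := hex
      obtain ⟨m, hm⟩ := Nat.exists_eq_add_of_le hi.le
      obtain ⟨m', hm'⟩ := Nat.exists_eq_add_of_le (hi.le.trans hj)
      rw [hm, hm', π.seeds_const L he, π.seeds_const L he]
    · push Not at hex
      have hcard : ∀ i ≤ Fintype.card G.V, i ≤ (π.seeds L i).card := by
        intro i
        induction i with
        | zero => simp
        | succ i ih =>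
          intro hi
          have h1 := ih (by omega)
          have h2 : (π.seeds L i).card < (π.seeds L (i + 1)).card :=
            Finset.card_lt_card
              (lt_of_le_of_ne (π.seeds_subset_succ L i) (hex i (by omega)).symm)
          omega
      have huniv : π.seeds L (Fintype.card G.V) = Finset.univ :=
        Finset.eq_univ_of_card _
          (le_antisymm (Finset.card_le_univ _) (hcard _ le_rfl))
      refine le_antisymm (π.seeds_mono L hj) ?_
      rw [huniv]
      exact Finset.subset_univ _

end Policy

/-- `OPT_A(G, k)`: the optimal value of `σ(π)` over the adaptive policies `π` with `|π| = k`. -/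
def optA (G : InfluenceGraph.{u}) (k : ℕ) : ℝ :=
  sSup {x : ℝ | ∃ π : G.Policy, π.HasSize k ∧ x = π.spread}

/-- The class of `α`-bounded influence graphs: the underlying graph is an undirected (simple) graph
`H`, every undirected edge `{u, v}` standing for the two directed edges `(u, v)` and `(v, u)` with
possibly distinct probabilities, and the sum of the node degrees of `H` that are larger than `2`
is at most `α`. -/
def alphaBounded (α : ℕ) : Set InfluenceGraph.{u} :=
  {G | ∃ H : SimpleGraph G.V, (∀ a b, G.graph.Adj a b ↔ H.Adj a b) ∧
    ∑ v ∈ Finset.univ.filter (fun v => 2 < H.degree v), H.degree v ≤ α}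

end InfluenceGraph

/-- The `k`-adaptivity gap `AG(𝒢, k) = sup_{G ∈ 𝒢} OPT_A(G, k) / OPT_N(G, k)`, as an extended
nonnegative real number. The supremum is over the graphs of `𝒢` with at least `k` nodes, those in
which a choice of `k` seed nodes is possible at all. -/
def kAdaptivityGap (𝒢 : Set InfluenceGraph.{u}) (k : ℕ) : ENNReal :=
  ⨆ G : InfluenceGraph.{u}, ⨆ _ : G ∈ 𝒢, ⨆ _ : k ≤ Fintype.card G.V,
    ENNReal.ofReal (G.optA k) / ENNReal.ofReal (G.optN k)

/-- The adaptivity gap `AG(𝒢) = sup_{k ≥ 1} AG(𝒢, k)`. -/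
def adaptivityGap (𝒢 : Set InfluenceGraph.{u}) : ENNReal :=
  ⨆ k : ℕ, ⨆ _ : 1 ≤ k, kAdaptivityGap 𝒢 k

end

noncomputable section

namespace InfluenceGraph

open scoped Classical

variable {G : InfluenceGraph.{u}}

/-! ### Expectations -/

/-! Let a policy `π` with `k` seeds be given a node set `X` for free, together with everything
reachable from the boundary of `X`. A node gained beyond that is reached by a walk avoiding `X`.
What `π` has observed depends only on edges leaving reached nodes, so the gain of its next seed `v`
is governed by fresh edges and has mean at most `spreadOff X v`. This gives
`Policy.spread_le_add_expect_sum`: σ(π) is at most |X| + σ(∂X) plus the expected sum of `spreadOff X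
v` over the seeds.

Take X = R(S, L) with |S| ≤ k and `L` independent of the run. Growing `X` from `S` along live edges
changes the boundary by at most deg − 2 per new node, so |∂X| ≤ 2k + α. As σ(T)/|T| is at most
OPT_N/k when |T| ≥ k, σ(∂X) ≤ (α/k + 2) OPT_N. Averaging over `L` turns |X| into σ(S) and each
`spreadOff X v` into at most the marginal gain of `v` over `S`. Hence the best node closes a 1/k
fraction of the distance from σ(S) to B = σ(π) − (α/k + 2) OPT_N (`Policy.HasSize.exists_gain`), and
`k` greedy steps give (1 − (1 − 1/k)^k) B ≤ OPT_N.

The bound `k` is the case X = ∅. One of the two bounds decreases and the other increases in `k` once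
(1 − 1/k)^k is replaced by 1/e; they cross at `gapRoot α`. -/

theorem liveProb_eq_prod (L : G.LiveEdgeGraph) :
    G.liveProb L = ∏ e, if e ∈ L then G.p e else 1 - G.p e := by
  unfold liveProb
  rw [← Finset.prod_mul_prod_compl L (fun e => if e ∈ L then G.p e else 1 - G.p e)]
  congr 1
  · exact Finset.prod_congr rfl fun e he => by simp [he]
  · exact Finset.prod_congr rfl fun e he => by simp [Finset.mem_compl.1 he]

theorem liveProb_nonneg (L : G.LiveEdgeGraph) : 0 ≤ G.liveProb L := by
  rw [liveProb_eq_prod]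
  refine Finset.prod_nonneg fun e _ => ?_
  have := G.p_mem e
  split_ifs
  · exact this.1
  · linarith [this.2]

theorem sum_liveProb : ∑ L : G.LiveEdgeGraph, G.liveProb L = 1 := by
  have h := Finset.prod_add (fun e : G.Edge => G.p e) (fun e => 1 - G.p e) Finset.univ
  simp only [add_sub_cancel, Finset.prod_const_one, Finset.powerset_univ] at h
  rw [h]
  exact Finset.sum_congr rfl fun L _ => by rw [liveProb, Finset.compl_eq_univ_sdiff]

theorem expect_const (c : ℝ) : G.expect (fun _ => c) = c := by
  rw [expect, ← Finset.sum_mul, sum_liveProb, one_mul]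

theorem expect_mono {X Y : G.LiveEdgeGraph → ℝ} (h : ∀ L, X L ≤ Y L) :
    G.expect X ≤ G.expect Y :=
  Finset.sum_le_sum fun L _ => mul_le_mul_of_nonneg_left (h L) (liveProb_nonneg L)

theorem expect_add (X Y : G.LiveEdgeGraph → ℝ) :
    G.expect (fun L => X L + Y L) = G.expect X + G.expect Y := by
  simp only [expect, mul_add, Finset.sum_add_distrib]

theorem expect_mul_const (X : G.LiveEdgeGraph → ℝ) (c : ℝ) :
    G.expect (fun L => X L * c) = G.expect X * c := by
  simp only [expect, Finset.sum_mul, mul_assoc]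

theorem expect_sum {ι : Type*} (s : Finset ι) (X : ι → G.LiveEdgeGraph → ℝ) :
    G.expect (fun L => ∑ i ∈ s, X i L) = ∑ i ∈ s, G.expect (X i) := by
  simp only [expect, Finset.mul_sum]
  exact Finset.sum_comm

theorem expect_comm (X : G.LiveEdgeGraph → G.LiveEdgeGraph → ℝ) :
    G.expect (fun L => G.expect fun L' => X L L') =
      G.expect fun L' => G.expect fun L => X L L' := by
  simp only [expect, Finset.mul_sum]
  rw [Finset.sum_comm]
  exact Finset.sum_congr rfl fun _ _ => Finset.sum_congr rfl fun _ _ => by ring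

theorem expect_nonneg {X : G.LiveEdgeGraph → ℝ} (h : ∀ L, 0 ≤ X L) : 0 ≤ G.expect X :=
  Finset.sum_nonneg fun L _ => mul_nonneg (liveProb_nonneg L) (h L)

/-- The live-edge graph that agrees with `L` on `A` and with `L'` off `A`. -/
def splice (A : Finset G.Edge) (L L' : G.LiveEdgeGraph) : G.LiveEdgeGraph :=
  Finset.univ.filter fun e => if e ∈ A then e ∈ L else e ∈ L'

theorem mem_splice {A : Finset G.Edge} {L L' : G.LiveEdgeGraph} {e : G.Edge} :
    e ∈ splice A L L' ↔ if e ∈ A then e ∈ L else e ∈ L' := by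
  simp [splice]

/-- Splicing both ways only exchanges, edge by edge, the factors of `L` and `L'`. -/
theorem liveProb_splice (A : Finset G.Edge) (L L' : G.LiveEdgeGraph) :
    G.liveProb (splice A L L') * G.liveProb (splice A L' L) = G.liveProb L * G.liveProb L' := by
  simp only [liveProb_eq_prod, ← Finset.prod_mul_distrib]
  refine Finset.prod_congr rfl fun e _ => ?_
  simp only [mem_splice]
  by_cases he : e ∈ A <;> simp [he, mul_comm]

/-- Decoupling: if `Z` is determined by the edges in `A (Z L)` and `F z` by the edges outside `A z`,
then `F (Z L) L` has the same expectation as `F (Z L) L'` for an independent `L'`. -/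
theorem expect_decouple {β : Type*} (Z : G.LiveEdgeGraph → β) (A : β → Finset G.Edge)
    (F : β → G.LiveEdgeGraph → ℝ)
    (hZ : ∀ L L', (∀ e ∈ A (Z L), e ∈ L ↔ e ∈ L') → Z L' = Z L)
    (hF : ∀ z L L', (∀ e ∉ A z, e ∈ L ↔ e ∈ L') → F z L = F z L') :
    G.expect (fun L => F (Z L) L) = G.expect fun L => G.expect fun L' => F (Z L) L' := by
  have h1 : G.expect (fun L => F (Z L) L) =
      G.expect fun L => G.expect fun _ => F (Z L) L := by
    simp only [expect_const]
  rw [h1]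
  simp only [expect, Finset.mul_sum]
  rw [← Fintype.sum_prod_type', ← Fintype.sum_prod_type']
  have hZs : ∀ L L', Z (splice (A (Z L)) L L') = Z L := fun L L' =>
    hZ _ _ fun e he => by simp [mem_splice, he]
  -- Exchange the two graphs off `A (Z L)`. By `hZs` the value of `Z` at the first component
  -- survives, so the same edge set is used when exchanging back.
  let i : G.LiveEdgeGraph × G.LiveEdgeGraph → G.LiveEdgeGraph × G.LiveEdgeGraph :=
    fun x => (splice (A (Z x.1)) x.1 x.2, splice (A (Z x.1)) x.2 x.1)
  have hi : Function.Involutive i := by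
    rintro ⟨L, L'⟩
    simp only [i, hZs]
    refine Prod.ext ?_ ?_ <;> ext e <;> by_cases he : e ∈ A (Z L) <;> simp [mem_splice, he]
  refine Fintype.sum_bijective i hi.bijective _ _ ?_
  rintro ⟨L, L'⟩
  simp only [i, hZs]
  rw [← mul_assoc, ← mul_assoc, liveProb_splice]
  congr 1
  exact hF _ _ _ fun e he => by simp [mem_splice, he]

/-! ### Reachability -/

theorem mem_reach_of_mem {S : Finset G.V} {L : G.LiveEdgeGraph} {s : G.V} (hs : s ∈ S) :
    s ∈ G.reach S L := by
  simp only [reach, Finset.mem_filter, Finset.mem_univ, true_and]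
  exact ⟨s, hs, Relation.ReflTransGen.refl⟩

theorem subset_reach (S : Finset G.V) (L : G.LiveEdgeGraph) : S ⊆ G.reach S L :=
  fun _ => mem_reach_of_mem

theorem mem_reach_of_edge {S : Finset G.V} {L : G.LiveEdgeGraph} {e : G.Edge} (he : e ∈ L)
    (ha : e.1.1 ∈ G.reach S L) : e.1.2 ∈ G.reach S L := by
  simp only [reach, Finset.mem_filter, Finset.mem_univ, true_and] at ha ⊢
  obtain ⟨s, hs, h⟩ := ha
  exact ⟨s, hs, h.tail ⟨e.2, he⟩⟩

/-- A set containing `S` and closed under live edges leaving the reached nodes contains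
`R(S, L)`. -/
theorem reach_subset_of_closed {S X : Finset G.V} {L : G.LiveEdgeGraph} (hS : S ⊆ X)
    (hX : ∀ e ∈ L, e.1.1 ∈ G.reach S L → e.1.1 ∈ X → e.1.2 ∈ X) : G.reach S L ⊆ X := by
  intro v hv
  simp only [reach, Finset.mem_filter, Finset.mem_univ, true_and] at hv
  obtain ⟨s, hs, h⟩ := hv
  suffices v ∈ G.reach S L ∧ v ∈ X from this.2
  induction h with
  | refl => exact ⟨mem_reach_of_mem hs, hS hs⟩
  | tail _ h2 ih =>
    obtain ⟨h, he⟩ := h2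
    exact ⟨mem_reach_of_edge he ih.1, hX _ he ih.1 ih.2⟩

theorem reach_mono {S T : Finset G.V} {L L' : G.LiveEdgeGraph} (h : S ⊆ T) (hL : L ⊆ L') :
    G.reach S L ⊆ G.reach T L' :=
  reach_subset_of_closed (h.trans (subset_reach _ _)) fun _ he _ h => mem_reach_of_edge (hL he) h

theorem mem_reach_iff {S : Finset G.V} {L : G.LiveEdgeGraph} {w : G.V} :
    w ∈ G.reach S L ↔ ∃ s ∈ S, w ∈ G.reach {s} L := by
  simp [reach]

theorem reach_union (S T : Finset G.V) (L : G.LiveEdgeGraph) :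
    G.reach (S ∪ T) L = G.reach S L ∪ G.reach T L := by
  ext w
  simp only [Finset.mem_union, mem_reach_iff (S := S ∪ T), mem_reach_iff (S := S),
    mem_reach_iff (S := T), or_and_right, exists_or]

/-- Only edges leaving reached nodes are ever consulted, so agreement there decides the reached set.
-/
theorem reach_congr {S X : Finset G.V} {L L' : G.LiveEdgeGraph} (hS : G.reach S L ⊆ X)
    (h : ∀ e : G.Edge, e.1.1 ∈ X → (e ∈ L ↔ e ∈ L')) : G.reach S L' = G.reach S L := by
  have h1 : G.reach S L' ⊆ G.reach S L :=
    reach_subset_of_closed (subset_reach _ _) fun e he _ ha =>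
      mem_reach_of_edge ((h e (hS ha)).2 he) ha
  refine h1.antisymm (reach_subset_of_closed (subset_reach _ _) fun e he ha ha' => ?_)
  exact mem_reach_of_edge ((h e (hS ha)).1 he) ha'

/-- The nodes reachable in `L` from `S` by walks that avoid `X`. -/
def reachOff (X S : Finset G.V) (L : G.LiveEdgeGraph) : Finset G.V :=
  G.reach (S \ X) (L.filter fun e => e.1.2 ∉ X)

theorem reachOff_empty (S : Finset G.V) (L : G.LiveEdgeGraph) : reachOff ∅ S L = G.reach S L := by
  simp [reachOff]

theorem disjoint_reachOff (X S : Finset G.V) (L : G.LiveEdgeGraph) :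
    Disjoint X (reachOff X S L) := by
  rw [Finset.disjoint_right]
  intro v hv hX
  have : reachOff X S L ⊆ Xᶜ :=
    reach_subset_of_closed (fun v hv => by simpa using (Finset.mem_sdiff.1 hv).2)
      fun e he _ _ => by simpa using (Finset.mem_filter.1 he).2
  exact Finset.mem_compl.1 (this hv) hX

theorem reachOff_subset_reach (X S : Finset G.V) (L : G.LiveEdgeGraph) :
    reachOff X S L ⊆ G.reach S L :=
  reach_mono Finset.sdiff_subset (Finset.filter_subset _ _)

theorem mem_reachOff_of_edge {X S : Finset G.V} {L : G.LiveEdgeGraph} {e : G.Edge} (he : e ∈ L)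
    (h2 : e.1.2 ∉ X) (ha : e.1.1 ∈ reachOff X S L) : e.1.2 ∈ reachOff X S L :=
  mem_reach_of_edge (Finset.mem_filter.2 ⟨he, h2⟩) ha

theorem reachOff_anti {X Y : Finset G.V} (h : X ⊆ Y) (S : Finset G.V) (L : G.LiveEdgeGraph) :
    reachOff Y S L ⊆ reachOff X S L :=
  reach_mono (Finset.sdiff_subset_sdiff Finset.Subset.rfl h)
    (Finset.monotone_filter_right _ fun _ _ he hX => he (h hX))

theorem reachOff_congr {X S : Finset G.V} {L L' : G.LiveEdgeGraph}
    (h : ∀ e : G.Edge, e.1.1 ∉ X → (e ∈ L ↔ e ∈ L')) : reachOff X S L = reachOff X S L' := by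
  refine (reach_congr (X := Xᶜ) ?_ ?_).symm
  · intro v hv
    exact Finset.mem_compl.2 (Finset.disjoint_right.1 (disjoint_reachOff X S L) hv)
  · intro e he
    simp [h e (Finset.mem_compl.1 he)]

/-- The nodes outside `X` that have an incoming edge from `X`. -/
def outBoundary (X : Finset G.V) : Finset G.V :=
  Finset.univ.filter fun w => w ∉ X ∧ ∃ v ∈ X, G.graph.Adj v w

/-- The nodes reached from `S`, except those in `X` or reached through `X`. -/
def reachNew (X S : Finset G.V) (L : G.LiveEdgeGraph) : Finset G.V :=
  G.reach S L \ (X ∪ G.reach (outBoundary X) L)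

theorem reach_empty (L : G.LiveEdgeGraph) : G.reach ∅ L = ∅ := by simp [reach]

theorem card_reach_le (X S : Finset G.V) (L : G.LiveEdgeGraph) :
    (G.reach S L).card ≤
      X.card + (G.reach (outBoundary X) L).card + (reachNew X S L).card := by
  have h : G.reach S L ⊆ (X ∪ G.reach (outBoundary X) L) ∪ reachNew X S L := by
    intro v hv
    by_cases h : v ∈ X ∪ G.reach (outBoundary X) L
    · exact Finset.mem_union_left _ h
    · exact Finset.mem_union_right _ (Finset.mem_sdiff.2 ⟨hv, h⟩)
  have h1 := Finset.card_le_card h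
  have h2 := Finset.card_union_le (X ∪ G.reach (outBoundary X) L) (reachNew X S L)
  have h3 := Finset.card_union_le X (G.reach (outBoundary X) L)
  omega

/-- A walk from `v` that enters R(S, L) stays there, and one that leaves `X` does so into the
boundary. Every other node of the walk is reached avoiding both sets. -/
theorem reachNew_insert_subset (X S : Finset G.V) (v : G.V) (L : G.LiveEdgeGraph) :
    reachNew X (insert v S) L ⊆
      reachNew X S L ∪ reachOff (X ∪ G.reach S L) {v} L := by
  have h : G.reach {v} L ⊆ ((X ∪ G.reach S L) ∪ G.reach (outBoundary X) L) ∪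
      reachOff (X ∪ G.reach S L) {v} L := by
    refine reach_subset_of_closed ?_ fun e he _ ha => ?_
    · intro w hw
      by_cases h : w ∈ X ∪ G.reach S L
      · exact Finset.mem_union_left _ (Finset.mem_union_left _ h)
      · exact Finset.mem_union_right _ (subset_reach _ _ (Finset.mem_sdiff.2 ⟨hw, h⟩))
    · by_cases h2 : e.1.2 ∈ X ∪ G.reach S L
      · exact Finset.mem_union_left _ (Finset.mem_union_left _ h2)
      have h2X : e.1.2 ∉ X := fun h => h2 (Finset.mem_union_left _ h)
      simp only [Finset.mem_union] at ha
      rcases ha with ((ha | ha) | ha) | ha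
      · refine Finset.mem_union_left _ (Finset.mem_union_right _ (subset_reach _ _ ?_))
        simp only [outBoundary, Finset.mem_filter, Finset.mem_univ, true_and]
        exact ⟨h2X, _, ha, e.2⟩
      · exact absurd (Finset.mem_union_right _ (mem_reach_of_edge he ha)) h2
      · exact Finset.mem_union_left _ (Finset.mem_union_right _ (mem_reach_of_edge he ha))
      · exact Finset.mem_union_right _ (mem_reachOff_of_edge he h2 ha)
  intro w hw
  obtain ⟨hw1, hw2⟩ := Finset.mem_sdiff.1 hw
  rw [Finset.insert_eq, reach_union, Finset.mem_union] at hw1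
  by_cases hS : w ∈ G.reach S L
  · exact Finset.mem_union_left _ (Finset.mem_sdiff.2 ⟨hS, hw2⟩)
  have hv := h (hw1.resolve_right hS)
  simp only [Finset.mem_union] at hv hw2 ⊢
  tauto

/-! ### Adaptive policies -/

theorem dom_restrict (L : G.LiveEdgeGraph) (S : Finset G.V) : (G.restrict L S).dom = S := by
  ext v
  by_cases h : v ∈ S <;> simp [PartialRealisation.dom, restrict, h]

theorem reached_restrict (L : G.LiveEdgeGraph) (S : Finset G.V) :
    (G.restrict L S).reached = G.reach S L := by
  ext w
  rw [mem_reach_iff]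
  simp only [PartialRealisation.reached, Finset.mem_filter, Finset.mem_univ, true_and]
  simp only [restrict, realisation]
  constructor
  · rintro ⟨v, A, h, hw⟩
    by_cases hv : v ∈ S
    · simp only [hv, if_true, Option.some.injEq] at h
      exact ⟨v, hv, h ▸ hw⟩
    · simp [hv] at h
  · rintro ⟨s, hs, hw⟩
    exact ⟨s, _, by simp [hs], hw⟩

theorem restrict_congr {S X : Finset G.V} {L L' : G.LiveEdgeGraph} (hS : G.reach S L ⊆ X)
    (h : ∀ e : G.Edge, e.1.1 ∈ X → (e ∈ L ↔ e ∈ L')) : G.restrict L' S = G.restrict L S := by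
  refine Subtype.ext (funext fun v => ?_)
  simp only [restrict]
  by_cases hv : v ∈ S
  · simp only [hv, if_true, realisation, Option.some.injEq]
    exact reach_congr ((reach_mono (by simpa using hv) Finset.Subset.rfl).trans hS) h
  · simp [hv]

/-- The expected number of nodes reached from `v` in `G - X`. -/
def spreadOff (X : Finset G.V) (v : G.V) : ℝ :=
  G.expect fun L => ((reachOff X {v} L).card : ℝ)

theorem spreadOff_anti {X Y : Finset G.V} (h : X ⊆ Y) (v : G.V) :
    spreadOff Y v ≤ spreadOff X v :=
  expect_mono fun L => Nat.cast_le.2 (Finset.card_le_card (reachOff_anti h _ L))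

theorem spreadOff_of_mem {X : Finset G.V} {v : G.V} (h : v ∈ X) : spreadOff X v = 0 := by
  have : ∀ L, reachOff X {v} L = ∅ := fun L => by
    have hs : ({v} : Finset G.V) \ X = ∅ := by simpa using h
    rw [reachOff, hs, reach_empty]
  simp [spreadOff, this, expect_const]

/-- The edges with source in `X`. -/
def edgesFrom (X : Finset G.V) : Finset G.Edge := Finset.univ.filter fun e => e.1.1 ∈ X

theorem mem_edgesFrom {X : Finset G.V} {e : G.Edge} : e ∈ edgesFrom X ↔ e.1.1 ∈ X := by
  simp [edgesFrom]

namespace Policy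

/-- Full-adoption feedback reveals nothing about edges leaving unreached nodes, so these cannot
influence the run. -/
theorem seeds_congr (π : G.Policy) {L L' : G.LiveEdgeGraph} {j : ℕ}
    (h : ∀ e : G.Edge, e.1.1 ∈ G.reach (π.seeds L j) L → (e ∈ L ↔ e ∈ L')) :
    ∀ i ≤ j, π.seeds L' i = π.seeds L i := by
  intro i
  induction i with
  | zero => intro _; rfl
  | succ i ih =>
    intro hi
    have h1 := ih (by omega)
    have h2 : G.restrict L' (π.seeds L i) = G.restrict L (π.seeds L i) :=
      restrict_congr (reach_mono (π.seeds_mono L (by omega)) Finset.Subset.rfl) h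
    rw [seeds, seeds, h1, h2]

theorem observed_congr (π : G.Policy) {L L' : G.LiveEdgeGraph} {j : ℕ}
    (h : ∀ e : G.Edge, e.1.1 ∈ G.reach (π.seeds L j) L → (e ∈ L ↔ e ∈ L')) :
    π.observed L' j = π.observed L j := by
  rw [observed, observed, π.seeds_congr h j le_rfl]
  exact restrict_congr Finset.Subset.rfl h

/-- The expected number of nodes outside `X` gained, given the observation `ψ`, by the next
choice of the policy. -/
theorem expect_card_reachOff_next (π : G.Policy) (X : Finset G.V) (j : ℕ) :
    G.expect (fun L => (π (π.observed L j)).elim 0 fun v =>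
      ((reachOff (X ∪ G.reach (π.seeds L j) L) {v} L).card : ℝ)) =
    G.expect fun L => (π (π.observed L j)).elim 0 fun v =>
      spreadOff (X ∪ G.reach (π.seeds L j) L) v := by
  -- The observation uses edges leaving reached nodes, the gain avoiding those nodes uses only the
  -- others.
  have h := expect_decouple (fun L => π.observed L j) (fun ψ => edgesFrom ψ.reached)
    (fun ψ L => (π ψ).elim 0 fun v => ((reachOff (X ∪ ψ.reached) {v} L).card : ℝ)) ?_ ?_
  · simp only [observed, reached_restrict] at h ⊢
    rw [h]
    congr 1
    ext L
    cases π (G.restrict L (π.seeds L j)) <;> simp [expect_const, spreadOff]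
  · intro L L' h
    refine π.observed_congr fun e he => h e ?_
    rwa [mem_edgesFrom, observed, reached_restrict]
  · intro ψ L L' h
    cases π ψ with
    | none => rfl
    | some v =>
      simp only [Option.elim]
      rw [reachOff_congr (L' := L') fun e he => h e ?_]
      rw [mem_edgesFrom]
      exact fun h => he (Finset.mem_union_right _ h)

/-- Induction over the rounds: the conditional mean gain of a new seed only grows when the already
reached nodes are no longer forbidden. -/
theorem expect_card_reachNew_le (π : G.Policy) (X : Finset G.V) (j : ℕ) :
    G.expect (fun L => ((reachNew X (π.seeds L j) L).card : ℝ)) ≤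
      G.expect fun L => ∑ v ∈ π.seeds L j, spreadOff X v := by
  induction j with
  | zero =>
    refine expect_mono fun L => ?_
    simp [seeds, reachNew, reach_empty]
  | succ j ih =>
    have h1 : G.expect (fun L => ((reachNew X (π.seeds L (j + 1)) L).card : ℝ)) ≤
        G.expect fun L => ((reachNew X (π.seeds L j) L).card : ℝ) +
          (π (π.observed L j)).elim 0 fun v =>
            ((reachOff (X ∪ G.reach (π.seeds L j) L) {v} L).card : ℝ) := by
      refine expect_mono fun L => ?_
      rw [seeds]
      simp only [observed]
      cases π (G.restrict L (π.seeds L j)) with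
      | none => simp
      | some v =>
        simp only [Option.elim]
        exact_mod_cast (Finset.card_le_card (reachNew_insert_subset X _ v L)).trans
          (Finset.card_union_le _ _)
    refine h1.trans ?_
    rw [expect_add, expect_card_reachOff_next]
    refine (add_le_add_left ih _).trans ?_
    rw [← expect_add]
    refine expect_mono fun L => ?_
    rw [seeds]
    simp only [observed]
    cases π (G.restrict L (π.seeds L j)) with
    | none => simp
    | some v =>
      simp only [Option.elim]
      -- A policy may choose an old seed again; it lies in the reached set and gains nothing.
      by_cases hv : v ∈ π.seeds L j
      · rw [Finset.insert_eq_of_mem hv, spreadOff_of_mem, add_zero]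
        exact Finset.mem_union_right _ (mem_reach_of_mem hv)
      · rw [Finset.sum_insert hv, add_comm]
        gcongr
        exact spreadOff_anti Finset.subset_union_left v

theorem spread_eq (π : G.Policy) :
    π.spread = G.expect fun L => ((G.reach (π.seeds L (Fintype.card G.V)) L).card : ℝ) := by
  simp only [spread, output, observed, reached_restrict]

theorem HasSize.card_seeds {π : G.Policy} {k : ℕ} (h : π.HasSize k) (L : G.LiveEdgeGraph) :
    (π.seeds L (Fintype.card G.V)).card = k := by
  have := (h L).2
  rwa [output, observed, dom_restrict] at this

/-- The expected number of nodes that `π` reaches, when a set `X` and everything that can be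
reached through `X` is given for free. -/
theorem spread_le_add_expect_sum (π : G.Policy) (X : Finset G.V) :
    π.spread ≤ X.card + G.spread (outBoundary X) +
      G.expect fun L => ∑ v ∈ π.seeds L (Fintype.card G.V), spreadOff X v := by
  refine le_trans ?_ (add_le_add_right (π.expect_card_reachNew_le X _) _)
  rw [spread_eq, InfluenceGraph.spread, ← expect_const (G := G) (X.card : ℝ), ← expect_add,
    ← expect_add]
  exact expect_mono fun _ => by exact_mod_cast card_reach_le X _ _

end Policy

/-! ### Spread of seed sets -/

theorem spread_mono {S T : Finset G.V} (h : S ⊆ T) : G.spread S ≤ G.spread T :=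
  expect_mono fun _ => Nat.cast_le.2 (Finset.card_le_card (reach_mono h Finset.Subset.rfl))

theorem spread_nonneg (S : Finset G.V) : 0 ≤ G.spread S := expect_nonneg fun _ => Nat.cast_nonneg _

theorem spread_empty : G.spread ∅ = 0 := by simp [spread, reach_empty, expect_const]

theorem spreadOff_empty (v : G.V) : spreadOff ∅ v = G.spread {v} := by
  simp only [spreadOff, spread, reachOff_empty]

/-- The marginal gain of `v` is the expected spread of `v` outside the nodes reached from `S`,
in an independent live-edge graph. -/
theorem expect_spreadOff_le (S : Finset G.V) (v : G.V) :
    G.spread S + G.expect (fun L => spreadOff (G.reach S L) v) ≤ G.spread (insert v S) := by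
  have h := expect_decouple (fun L => G.reach S L) edgesFrom
    (fun X L => ((reachOff X {v} L).card : ℝ))
    (fun L L' h => reach_congr Finset.Subset.rfl fun e he => h e (mem_edgesFrom.2 he))
    (fun X L L' h => by
      rw [reachOff_congr fun e he => h e (by rwa [mem_edgesFrom])])
  simp only [spreadOff]
  rw [← h, spread, spread, ← expect_add]
  refine expect_mono fun L => ?_
  rw [← Nat.cast_add, ← Finset.card_union_of_disjoint (disjoint_reachOff _ _ _), Nat.cast_le]
  refine Finset.card_le_card (Finset.union_subset ?_ ?_)
  · exact reach_mono (Finset.subset_insert _ _) Finset.Subset.rfl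
  · exact (reachOff_subset_reach _ _ _).trans (reach_mono (by simp) Finset.Subset.rfl)

theorem spread_le_optN {k : ℕ} (hk : k ≤ Fintype.card G.V) {S : Finset G.V} (hS : S.card ≤ k) :
    G.spread S ≤ G.optN k := by
  obtain ⟨T, hT, hc⟩ := Finset.exists_superset_card_eq hS hk
  refine (spread_mono hT).trans (le_csSup ?_ ⟨T, hc, rfl⟩)
  refine ⟨G.spread Finset.univ, ?_⟩
  rintro _ ⟨S, _, rfl⟩
  exact spread_mono (Finset.subset_univ S)

theorem optN_nonneg (k : ℕ) : 0 ≤ G.optN k :=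
  Real.sSup_nonneg (by rintro _ ⟨S, _, rfl⟩; exact spread_nonneg S)

/-- Nonnegativity of `c` covers an empty set of policies, whose `sSup` is `0`. -/
theorem optA_le {k : ℕ} {c : ℝ} (hc : 0 ≤ c) (h : ∀ π : G.Policy, π.HasSize k → π.spread ≤ c) :
    G.optA k ≤ c :=
  Real.sSup_le (by rintro _ ⟨π, hπ, rfl⟩; exact h π hπ) hc

/-- Removing a suitable node decreases the spread at most by its average share. -/
theorem exists_mul_spread_le_erase {T : Finset G.V} (hT : T.Nonempty) :
    ∃ t ∈ T, ((T.card : ℝ) - 1) * G.spread T ≤ T.card * G.spread (T.erase t) := by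
  have key : ((T.card : ℝ) - 1) * G.spread T ≤ ∑ t ∈ T, G.spread (T.erase t) := by
    simp only [spread]
    rw [← expect_sum, mul_comm, ← expect_mul_const]
    refine expect_mono fun L => ?_
    -- Fix one seed `s` reaching `w`: erasing any other seed keeps `w` reached.
    have h1 : ∀ w ∈ G.reach T L,
        T.card - 1 ≤ (T.filter fun t => w ∈ G.reach (T.erase t) L).card := by
      intro w hw
      obtain ⟨s, hs, hw⟩ := mem_reach_iff.1 hw
      rw [← Finset.card_erase_of_mem hs]
      refine Finset.card_le_card fun t ht => ?_
      rw [Finset.mem_erase] at ht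
      refine Finset.mem_filter.2 ⟨ht.2, mem_reach_iff.2 ⟨s, ?_, hw⟩⟩
      exact Finset.mem_erase.2 ⟨ht.1.symm, hs⟩
    have h2 := Finset.card_nsmul_le_sum _ _ _ h1
    simp only [smul_eq_mul] at h2
    have h3 : ∑ w ∈ G.reach T L, (T.filter fun t => w ∈ G.reach (T.erase t) L).card ≤
        ∑ t ∈ T, (G.reach (T.erase t) L).card := by
      simp only [Finset.card_eq_sum_ones, Finset.sum_filter]
      rw [Finset.sum_comm]
      refine Finset.sum_le_sum fun t _ => ?_
      rw [← Finset.sum_filter]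
      exact Finset.sum_le_sum_of_subset fun w hw => (Finset.mem_filter.1 hw).2
    have h4 : (((T.card - 1 : ℕ) : ℝ)) = (T.card : ℝ) - 1 := by
      rw [Nat.cast_sub hT.card_pos, Nat.cast_one]
    rw [← h4]
    exact_mod_cast h2.trans h3
  obtain ⟨t, ht, h⟩ := Finset.exists_max_image T (fun t => G.spread (T.erase t)) hT
  refine ⟨t, ht, key.trans ?_⟩
  rw [← nsmul_eq_mul]
  exact Finset.sum_le_card_nsmul _ _ _ h

/-- Erasing well-chosen nodes down to `k` of them never lowers the spread per seed. -/
theorem mul_spread_le_card_mul_optN {k : ℕ} (hk : k ≤ Fintype.card G.V) :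
    ∀ (m : ℕ) (T : Finset G.V), T.card = k + m → (k : ℝ) * G.spread T ≤ T.card * G.optN k := by
  intro m
  induction m with
  | zero =>
    intro T hT
    rw [hT, add_zero]
    gcongr
    exact spread_le_optN hk hT.le
  | succ m ih =>
    intro T hT
    obtain ⟨t, ht, h⟩ := exists_mul_spread_le_erase (T := T) (Finset.card_pos.1 (by omega))
    have hc := Finset.card_erase_of_mem ht
    have h2 := ih (T.erase t) (by omega)
    have h3 : ((T.erase t).card : ℝ) = (T.card : ℝ) - 1 := by
      rw [hc, Nat.cast_sub (by omega), Nat.cast_one]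
    rw [h3] at h2
    have hT' : (T.card : ℝ) = k + m + 1 := by rw [hT]; push_cast; ring
    rcases Nat.eq_zero_or_pos (k + m) with h0 | h0
    -- Here |T| = 1, so the factor |T| − 1 cannot be cancelled.
    · have : k = 0 := by omega
      subst this
      simpa using mul_nonneg (Nat.cast_nonneg T.card) (optN_nonneg (G := G) 0)
    have hpos : (0 : ℝ) < (T.card : ℝ) - 1 := by
      rw [hT']
      have : (0 : ℝ) < ((k + m : ℕ) : ℝ) := by exact_mod_cast h0
      push_cast at this
      linarith
    refine le_of_mul_le_mul_left ?_ hpos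
    calc ((T.card : ℝ) - 1) * (k * G.spread T) = k * (((T.card : ℝ) - 1) * G.spread T) := by ring
      _ ≤ k * (T.card * G.spread (T.erase t)) := by gcongr
      _ = T.card * (k * G.spread (T.erase t)) := by ring
      _ ≤ T.card * (((T.card : ℝ) - 1) * G.optN k) := by gcongr
      _ = _ := by ring

theorem spread_le_of_card_le {k : ℕ} (hk0 : 0 < k) (hk : k ≤ Fintype.card G.V) {T : Finset G.V}
    {b : ℝ} (hT : (T.card : ℝ) ≤ b) (hb : (k : ℝ) ≤ b) : G.spread T ≤ b / k * G.optN k := by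
  have hk' : (0 : ℝ) < k := by exact_mod_cast hk0
  rw [div_mul_eq_mul_div, le_div_iff₀ hk', mul_comm]
  rcases le_total T.card k with h | h
  · exact mul_le_mul hb (spread_le_optN hk h) (spread_nonneg _) (hk'.le.trans hb)
  · obtain ⟨m, hm⟩ := Nat.exists_eq_add_of_le h
    exact (mul_spread_le_card_mul_optN hk m T hm).trans
      (mul_le_mul_of_nonneg_right hT (optN_nonneg k))

/-! ### The boundary of a reached set -/

/-- `w` itself leaves the boundary, and of its neighbours all but `a` may join it. -/
theorem card_outBoundary_insert (H : SimpleGraph G.V) (hH : ∀ a b, G.graph.Adj a b ↔ H.Adj a b)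
    {A : Finset G.V} {a w : G.V} (ha : a ∈ A) (hw : w ∉ A) (haw : H.Adj a w) :
    (outBoundary (insert w A)).card + 2 ≤ (outBoundary A).card + H.degree w := by
  have hwA : w ∈ outBoundary A := by
    simp only [outBoundary, Finset.mem_filter, Finset.mem_univ, true_and]
    exact ⟨hw, a, ha, (hH _ _).2 haw⟩
  have haN : a ∈ H.neighborFinset w := by simpa using haw.symm
  have hsub : outBoundary (insert w A) ⊆
      (outBoundary A).erase w ∪ (H.neighborFinset w).erase a := by
    intro x hx
    simp only [outBoundary, Finset.mem_filter, Finset.mem_univ, true_and, Finset.mem_insert,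
      not_or, Finset.mem_union, Finset.mem_erase, SimpleGraph.mem_neighborFinset] at hx ⊢
    obtain ⟨⟨hxw, hxA⟩, v, rfl | hv, hvx⟩ := hx
    · exact Or.inr ⟨fun h => hxA (h ▸ ha), (hH _ _).1 hvx⟩
    · exact Or.inl ⟨hxw, hxA, v, hv, hvx⟩
  have h1 := (Finset.card_le_card hsub).trans (Finset.card_union_le _ _)
  rw [Finset.card_erase_of_mem hwA, Finset.card_erase_of_mem haN,
    SimpleGraph.card_neighborFinset_eq_degree] at h1
  have h2 := Finset.card_pos.2 ⟨w, hwA⟩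
  have h3 := Finset.card_pos.2 ⟨a, haN⟩
  rw [SimpleGraph.card_neighborFinset_eq_degree] at h3
  omega

theorem card_outBoundary_le_sum_degree (H : SimpleGraph G.V)
    (hH : ∀ a b, G.graph.Adj a b ↔ H.Adj a b) (S : Finset G.V) :
    (outBoundary S).card ≤ ∑ v ∈ S, H.degree v := by
  have h : outBoundary S ⊆ S.biUnion fun v => H.neighborFinset v := by
    intro x hx
    simp only [outBoundary, Finset.mem_filter, Finset.mem_univ, true_and] at hx
    obtain ⟨_, v, hv, hvx⟩ := hx
    simp only [Finset.mem_biUnion, SimpleGraph.mem_neighborFinset]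
    exact ⟨v, hv, (hH _ _).1 hvx⟩
  refine (Finset.card_le_card h).trans (Finset.card_biUnion_le.trans ?_)
  simp

/-- The set grows from `S` one live edge at a time. The truncated difference makes nodes of degree
at most 2 free: absorbing one never enlarges the boundary. -/
theorem card_outBoundary_reach_le (H : SimpleGraph G.V)
    (hH : ∀ a b, G.graph.Adj a b ↔ H.Adj a b) (S : Finset G.V) (L : G.LiveEdgeGraph) :
    (outBoundary (G.reach S L)).card ≤
      2 * S.card + ∑ v ∈ G.reach S L, (H.degree v - 2) := by
  have grow : ∀ (n : ℕ) (A : Finset G.V), S ⊆ A → A ⊆ G.reach S L →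
      (G.reach S L \ A).card = n →
      (outBoundary A).card ≤ 2 * S.card + ∑ v ∈ A, (H.degree v - 2) →
      (outBoundary (G.reach S L)).card ≤ 2 * S.card + ∑ v ∈ G.reach S L, (H.degree v - 2) := by
    intro n
    induction n with
    | zero =>
      intro A _ hA hn h
      have : G.reach S L ⊆ A := Finset.sdiff_eq_empty_iff_subset.1 (Finset.card_eq_zero.1 hn)
      rwa [this.antisymm hA]
    | succ n ih =>
      intro A hSA hA hn h
      obtain ⟨e, he, heA, hw⟩ : ∃ e ∈ L, e.1.1 ∈ A ∧ e.1.2 ∉ A := by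
        by_contra! hcon
        have : G.reach S L ⊆ A := reach_subset_of_closed hSA fun e he _ ha => hcon e he ha
        rw [Finset.sdiff_eq_empty_iff_subset.2 this] at hn
        simp at hn
      have hwR : e.1.2 ∈ G.reach S L := mem_reach_of_edge he (hA heA)
      refine ih (insert e.1.2 A) (hSA.trans (Finset.subset_insert _ _))
        (Finset.insert_subset hwR hA) ?_ ?_
      · rw [Finset.sdiff_insert, Finset.card_erase_of_mem (Finset.mem_sdiff.2 ⟨hwR, hw⟩), hn]
        rfl
      · rw [Finset.sum_insert hw]
        have := card_outBoundary_insert H hH heA hw ((hH _ _).1 e.2)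
        omega
  refine grow _ S Finset.Subset.rfl (subset_reach _ _) rfl ?_
  refine (card_outBoundary_le_sum_degree H hH S).trans ?_
  calc ∑ v ∈ S, H.degree v ≤ ∑ v ∈ S, (2 + (H.degree v - 2)) :=
        Finset.sum_le_sum fun v _ => by omega
    _ = _ := by rw [Finset.sum_add_distrib, Finset.sum_const, smul_eq_mul, mul_comm]

theorem card_outBoundary_reach_le_of_alphaBounded {α : ℕ} (hG : G ∈ alphaBounded.{u} α)
    (S : Finset G.V) (L : G.LiveEdgeGraph) :
    (outBoundary (G.reach S L)).card ≤ 2 * S.card + α := by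
  obtain ⟨H, hH, hα⟩ := hG
  refine (card_outBoundary_reach_le H hH S L).trans (add_le_add_right (le_trans ?_ hα) _)
  calc ∑ v ∈ G.reach S L, (H.degree v - 2) ≤ ∑ v, (H.degree v - 2) :=
        Finset.sum_le_sum_of_subset (Finset.subset_univ _)
    _ ≤ ∑ v, if 2 < H.degree v then H.degree v else 0 :=
        Finset.sum_le_sum fun v _ => by split_ifs <;> omega
    _ = _ := (Finset.sum_filter _ _).symm

/-! ### Adaptive versus non-adaptive spread -/

theorem Policy.HasSize.spread_le_mul_optN {π : G.Policy} {k : ℕ} (hπ : π.HasSize k) (hk0 : 1 ≤ k)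
    (hk : k ≤ Fintype.card G.V) : π.spread ≤ k * G.optN k := by
  refine (π.spread_le_add_expect_sum ∅).trans ?_
  have h0 : outBoundary (G := G) ∅ = ∅ := by simp [outBoundary]
  rw [h0, spread_empty, Finset.card_empty, Nat.cast_zero, zero_add, zero_add,
    ← expect_const (G := G) (k * G.optN k)]
  refine expect_mono fun L => ?_
  rw [← hπ.card_seeds L, ← nsmul_eq_mul]
  refine Finset.sum_le_card_nsmul _ _ _ fun v _ => ?_
  rw [spreadOff_empty, hπ.card_seeds L]
  exact spread_le_optN hk (by simpa using hk0)

/-- Some node has a marginal gain that closes a `1 / k` fraction of the distance from `σ(S)`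
to the adaptive spread minus the spread of the boundary. -/
theorem Policy.HasSize.exists_gain {π : G.Policy} {k α : ℕ} (hπ : π.HasSize k) (hk0 : 1 ≤ k)
    (hk : k ≤ Fintype.card G.V) (hG : G ∈ alphaBounded.{u} α) {S : Finset G.V}
    (hS : S.card ≤ k) :
    ∃ v, π.spread ≤ G.spread S + ((α : ℝ) / k + 2) * G.optN k +
      k * (G.spread (insert v S) - G.spread S) := by
  have hne : (Finset.univ : Finset G.V).Nonempty :=
    Finset.card_pos.1 (by rw [Finset.card_univ]; omega)
  obtain ⟨v, -, hv⟩ := Finset.exists_max_image Finset.univ (fun v => G.spread (insert v S)) hne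
  refine ⟨v, ?_⟩
  have hk' : (0 : ℝ) < k := by exact_mod_cast hk0
  have hb : ∀ L, G.spread (outBoundary (G.reach S L)) ≤ ((α : ℝ) / k + 2) * G.optN k := by
    intro L
    have h1 : ((outBoundary (G.reach S L)).card : ℝ) ≤ α + 2 * k := by
      -- The 2 in α/k + 2 comes from the two boundary nodes allowed per seed of `S`.
      have := card_outBoundary_reach_le_of_alphaBounded hG S L
      exact_mod_cast (by omega : (outBoundary (G.reach S L)).card ≤ α + 2 * k)
    have h2 := spread_le_of_card_le hk0 hk h1 (by nlinarith [Nat.cast_nonneg (α := ℝ) α])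
    rwa [add_div, mul_div_cancel_right₀ _ hk'.ne'] at h2
  have h1 : π.spread ≤ G.expect fun L => ((G.reach S L).card : ℝ) +
      ((α : ℝ) / k + 2) * G.optN k +
      G.expect fun L' => ∑ w ∈ π.seeds L' (Fintype.card G.V), spreadOff (G.reach S L) w := by
    rw [← expect_const (G := G) π.spread]
    refine expect_mono fun L => (π.spread_le_add_expect_sum (G.reach S L)).trans ?_
    gcongr
    exact hb L
  -- With the expectations exchanged, the `k` seeds of the run on `L'` are fixed while `L` is
  -- averaged, so each summand is bounded by a marginal gain over `S`.
  rw [expect_add, expect_add, expect_const, expect_comm] at h1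
  refine h1.trans (add_le_add_right ?_ _)
  rw [← expect_const (G := G) (k * _)]
  refine expect_mono fun L' => ?_
  rw [expect_sum, ← hπ.card_seeds L', ← nsmul_eq_mul]
  refine Finset.sum_le_card_nsmul _ _ _ fun w _ => ?_
  have := expect_spreadOff_le S w
  have := hv w (Finset.mem_univ w)
  linarith

theorem Policy.HasSize.exists_greedy {π : G.Policy} {k α : ℕ} (hπ : π.HasSize k) (hk0 : 1 ≤ k)
    (hk : k ≤ Fintype.card G.V) (hG : G ∈ alphaBounded.{u} α) :
    ∀ i ≤ k, ∃ S : Finset G.V, S.card ≤ i ∧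
      (1 - (1 - 1 / (k : ℝ)) ^ i) * (π.spread - ((α : ℝ) / k + 2) * G.optN k) ≤ G.spread S := by
  have hk' : (0 : ℝ) < k := by exact_mod_cast hk0
  have hk1 : (1 : ℝ) / k ≤ 1 := by
    rw [div_le_one hk']
    exact_mod_cast hk0
  intro i
  induction i with
  | zero => exact fun _ => ⟨∅, by simp, by simp [spread_empty]⟩
  | succ i ih =>
    intro hi
    obtain ⟨S, hS, h⟩ := ih (by omega)
    obtain ⟨v, hv⟩ := hπ.exists_gain hk0 hk hG (S := S) (by omega)
    refine ⟨insert v S, (Finset.card_insert_le _ _).trans (by omega), ?_⟩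
    set B := π.spread - ((α : ℝ) / k + 2) * G.optN k with hB
    have h1 : 1 / (k : ℝ) * (B - G.spread S) ≤ G.spread (insert v S) - G.spread S := by
      rw [one_div, inv_mul_le_iff₀ hk']
      linarith
    -- The distance from the spread to `B` shrinks by the factor 1 − 1/k, whatever the sign of `B`.
    have h2 := mul_le_mul_of_nonneg_left h (sub_nonneg.2 hk1)
    rw [pow_succ]
    linarith

theorem one_sub_pow_pos {k : ℕ} (hk : 1 ≤ k) : 0 < 1 - (1 - 1 / (k : ℝ)) ^ k := by
  have hk' : (1 : ℝ) ≤ k := by exact_mod_cast hk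
  have h1 : 1 / (k : ℝ) ≤ 1 := (div_le_one (by linarith)).2 hk'
  have h0 : 0 < 1 / (k : ℝ) := by positivity
  have := pow_lt_one₀ (sub_nonneg.2 h1) (by linarith) (n := k) (by omega)
  linarith

theorem optA_le_mul_optN {k α : ℕ} (hk0 : 1 ≤ k) (hk : k ≤ Fintype.card G.V)
    (hG : G ∈ alphaBounded.{u} α) :
    G.optA k ≤ min (k : ℝ) ((α : ℝ) / k + 2 + 1 / (1 - (1 - 1 / (k : ℝ)) ^ k)) * G.optN k := by
  have hpos := one_sub_pow_pos hk0
  refine optA_le (mul_nonneg (le_min (by positivity) (by positivity)) (optN_nonneg k))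
    fun π hπ => ?_
  rw [min_mul_of_nonneg _ _ (optN_nonneg k)]
  refine le_min (hπ.spread_le_mul_optN hk0 hk) ?_
  obtain ⟨S, hS, h⟩ := hπ.exists_greedy hk0 hk hG k le_rfl
  have h1 := h.trans (spread_le_optN hk hS)
  rw [← le_div_iff₀' hpos] at h1
  rw [add_mul, one_div_mul_eq_div]
  linarith

end InfluenceGraph

/-! ### Bounds on the gap, uniformly in `k` -/

theorem kAdaptivityGap_alphaBounded_le {k : ℕ} (α : ℕ) (hk : 1 ≤ k) :
    kAdaptivityGap (InfluenceGraph.alphaBounded.{u} α) k ≤ ENNReal.ofReal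
      (min (k : ℝ) ((α : ℝ) / k + 2 + 1 / (1 - (1 - 1 / (k : ℝ)) ^ k))) := by
  have hpos := InfluenceGraph.one_sub_pow_pos hk
  -- The product form needs no positivity of OPT_N.
  refine iSup_le fun G => iSup_le fun hG => iSup_le fun hc => ENNReal.div_le_of_le_mul ?_
  rw [← ENNReal.ofReal_mul (le_min (by positivity) (by positivity))]
  exact ENNReal.ofReal_le_ofReal (InfluenceGraph.optA_le_mul_optN hk hc hG)

/-- The positive root `r` of `(e - 1) r ^ 2 = (3e - 2) r + (e - 1) α`. -/
def gapRoot (α : ℕ) : ℝ :=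
  (Real.sqrt (4 * (Real.exp 1 - 1) ^ 2 * (α : ℝ) + (3 * Real.exp 1 - 2) ^ 2)
    + 3 * Real.exp 1 - 2) / (2 * (Real.exp 1 - 1))

theorem two_lt_exp_one : 2 < Real.exp 1 := by linarith [Real.exp_one_gt_d9]

theorem gapRoot_le (α : ℕ) :
    gapRoot α ≤ Real.sqrt α + (3 * Real.exp 1 - 2) / (Real.exp 1 - 1) := by
  have he := two_lt_exp_one
  have hs := Real.sqrt_nonneg (α : ℝ)
  have hα : (0 : ℝ) ≤ α := Nat.cast_nonneg α
  have h1 : Real.sqrt (4 * (Real.exp 1 - 1) ^ 2 * (α : ℝ) + (3 * Real.exp 1 - 2) ^ 2) ≤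
      2 * (Real.exp 1 - 1) * Real.sqrt α + (3 * Real.exp 1 - 2) := by
    have h0 : 0 ≤ 2 * (Real.exp 1 - 1) * Real.sqrt α :=
      mul_nonneg (by linarith) hs
    refine Real.sqrt_le_iff.2 ⟨by linarith, ?_⟩
    have h2 : (2 * (Real.exp 1 - 1) * Real.sqrt α) ^ 2 = 4 * (Real.exp 1 - 1) ^ 2 * α := by
      rw [mul_pow, Real.sq_sqrt hα]
      ring
    have h3 : 0 ≤ 2 * (Real.exp 1 - 1) * Real.sqrt α * (3 * Real.exp 1 - 2) :=
      mul_nonneg h0 (by linarith)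
    rw [add_sq, h2]
    linarith
  have h4 : (0 : ℝ) < Real.exp 1 - 1 := by linarith
  rw [gapRoot, div_le_iff₀ (by linarith)]
  have h5 : (Real.sqrt α + (3 * Real.exp 1 - 2) / (Real.exp 1 - 1)) * (2 * (Real.exp 1 - 1)) =
      2 * (Real.exp 1 - 1) * Real.sqrt α + 2 * (3 * Real.exp 1 - 2) := by
    field_simp
  linarith

theorem le_gapRoot (α : ℕ) : (3 * Real.exp 1 - 2) / (Real.exp 1 - 1) ≤ gapRoot α := by
  have he := two_lt_exp_one
  have h4 : (0 : ℝ) < Real.exp 1 - 1 := by linarith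
  have h1 : 3 * Real.exp 1 - 2 ≤
      Real.sqrt (4 * (Real.exp 1 - 1) ^ 2 * (α : ℝ) + (3 * Real.exp 1 - 2) ^ 2) :=
    Real.le_sqrt_of_sq_le (le_add_of_nonneg_left (by positivity))
  rw [gapRoot, div_le_div_iff₀ h4 (by linarith)]
  nlinarith

/-- Dividing the quadratic equation by (e − 1) r exhibits the root as a fixed point, the form in
which α/k can be compared with α/r. -/
theorem gapRoot_eq (α : ℕ) :
    gapRoot α = α / gapRoot α + (3 * Real.exp 1 - 2) / (Real.exp 1 - 1) := by
  have he := two_lt_exp_one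
  have h4 : (0 : ℝ) < Real.exp 1 - 1 := by linarith
  have hr : 0 < gapRoot α := (div_pos (by linarith) h4).trans_le (le_gapRoot α)
  have hsq := Real.sq_sqrt
    (by positivity : 0 ≤ 4 * (Real.exp 1 - 1) ^ 2 * (α : ℝ) + (3 * Real.exp 1 - 2) ^ 2)
  have hs : Real.sqrt (4 * (Real.exp 1 - 1) ^ 2 * (α : ℝ) + (3 * Real.exp 1 - 2) ^ 2) =
      2 * (Real.exp 1 - 1) * gapRoot α - (3 * Real.exp 1 - 2) := by
    rw [gapRoot]
    field_simp
    ring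
  rw [hs] at hsq
  rw [div_add_div _ _ hr.ne' h4.ne', eq_div_iff (mul_pos hr h4).ne']
  refine mul_left_cancel₀ (mul_pos (by norm_num : (0 : ℝ) < 4) h4).ne' ?_
  linarith

theorem min_le_gapRoot {k : ℕ} (α : ℕ) (hk : 1 ≤ k) :
    min (k : ℝ) ((α : ℝ) / k + 2 + 1 / (1 - (1 - 1 / (k : ℝ)) ^ k)) ≤ gapRoot α := by
  have he := two_lt_exp_one
  have h4 : (0 : ℝ) < Real.exp 1 - 1 := by linarith
  have hr : 0 < gapRoot α := (div_pos (by linarith) h4).trans_le (le_gapRoot α)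
  -- Below the root `r` the bound `k` suffices; above it α/k ≤ α/r.
  rcases le_total (k : ℝ) (gapRoot α) with h | h
  · exact (min_le_left _ _).trans h
  refine (min_le_right _ _).trans ?_
  rw [gapRoot_eq, add_assoc]
  have h1 : (1 - 1 / (k : ℝ)) ^ k ≤ Real.exp (-1) :=
    Real.one_sub_div_pow_le_exp_neg (by exact_mod_cast hk)
  have h2 : 1 / (1 - (1 - 1 / (k : ℝ)) ^ k) ≤ Real.exp 1 / (Real.exp 1 - 1) := by
    rw [div_le_div_iff₀ (InfluenceGraph.one_sub_pow_pos hk) h4]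
    have h3 : Real.exp 1 * Real.exp (-1) = 1 := by rw [← Real.exp_add]; simp
    have := mul_le_mul_of_nonneg_left h1 (Real.exp_pos 1).le
    linarith
  have h5 : (3 * Real.exp 1 - 2) / (Real.exp 1 - 1) = 2 + Real.exp 1 / (Real.exp 1 - 1) := by
    field_simp
    ring
  rw [h5]
  gcongr

theorem adaptivityGap_alphaBounded_le (α : ℕ) :
    adaptivityGap (InfluenceGraph.alphaBounded.{u} α) ≤ ENNReal.ofReal (gapRoot α) :=
  iSup_le fun _ => iSup_le fun hk => (kAdaptivityGap_alphaBounded_le α hk).trans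
    (ENNReal.ofReal_le_ofReal (min_le_gapRoot α hk))

end

theorem theorem5p1 :
    (∀ α k : ℕ, 2 ≤ k →
      kAdaptivityGap (InfluenceGraph.alphaBounded.{u} α) k ≤
          ENNReal.ofReal (min (k : ℝ)
            ((α : ℝ) / (k : ℝ) + 2 + 1 / (1 - (1 - 1 / (k : ℝ)) ^ k))) ∧
        min (k : ℝ) ((α : ℝ) / (k : ℝ) + 2 + 1 / (1 - (1 - 1 / (k : ℝ)) ^ k)) ≤
          (Real.sqrt (4 * (Real.exp 1 - 1) ^ 2 * (α : ℝ) + (3 * Real.exp 1 - 2) ^ 2)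
            + 3 * Real.exp 1 - 2) / (2 * (Real.exp 1 - 1))) ∧
    (∀ α : ℕ, adaptivityGap (InfluenceGraph.alphaBounded.{u} α) ≤
      ENNReal.ofReal
        ((Real.sqrt (4 * (Real.exp 1 - 1) ^ 2 * (α : ℝ) + (3 * Real.exp 1 - 2) ^ 2)
          + 3 * Real.exp 1 - 2) / (2 * (Real.exp 1 - 1)))) ∧
    ∃ C : ℝ, ∀ α : ℕ, adaptivityGap (InfluenceGraph.alphaBounded.{u} α) ≤
      ENNReal.ofReal (Real.sqrt (α : ℝ) + C) := by
  exact ⟨fun α k hk => ⟨kAdaptivityGap_alphaBounded_le α (by omega), min_le_gapRoot α (by omega)⟩,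
    adaptivityGap_alphaBounded_le, _, fun α => (adaptivityGap_alphaBounded_le α).trans
      (ENNReal.ofReal_le_ofReal (gapRoot_le α))⟩
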